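/- Let $k$ be a field of characteristic $p\ge 0$ and let $S$ be a commutative noetherian $k$-algebra on which a finite group $G$ acts by $k$-algebra automorphisms. Put $R=S^G$ and assume that $R$ is noetherian too. If $p=0$, the only $p$-subgroup of a group, and its Sylow $p$-subgroup, is understood to be the trivial subgroup. Let $\mathrm{Syl}_p(G)\subseteq\mathcal S_p(G)$ be the sets of Sylow $p$-subgroups and of all $p$-subgroups of $G$. For $H\le G$ let $\mathrm{tr}_H^G\colon S^H\to R$, $x\mapsto\sum_{gH\in G/H}gx$, and let $I(H,S)$ be the ideal of $S$ generated by all $hs-s$ with $h\in H$, $s\in S$. Set $$T=\sum_{H\in\mathcal S_p(G)\smallsetminus\mathrm{Syl}_p(G)}\mathrm{tr}_H^G(S^H),\qquad I=\bigcap_{P\in\mathrm{Syl}_p(G)}I(P,S),$$ an ideal of $R$ and a $G$-stable ideal of $S$, and let $ST$ be the ideal of $S$ generated by $T$. Let $S^{[G]}$ (the Brauer quotient) be the quotient of $R=\mathrm{Hom}_{kG}(k,S)$ by the sum of the images $\mathrm{tr}_H^G(S^H)$ over the $p$-subgroups $H$ of $G$ with $p\mid [G:H]$, and let $S^{\oplus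 G}$ (the ring of invariant summands) be the quotient of $R=\mathrm{Hom}_{kG}(k,S)$ by the ideal of those homomorphisms $k\to S$ of $kG$-modules that are not split injective. Then there is a commutative diagram of ring homomorphisms $$\begin{array}{ccc} S^{[G]} & \xrightarrow{\ \iota_1\ } & S^{\oplus G}\\ {\scriptstyle\iota_2}\downarrow & & \downarrow{\scriptstyle\iota_3}\\ R/(R\cap ST) & \xrightarrow{\ \iota_4\ } & R/(R\cap I)\\ {\scriptstyle\rho_1}\downarrow & & \downarrow{\scriptstyle\rho_2}\\ (S/ST)^G & \xrightarrow{\ \iota_5\ } & (S/I)^G \end{array}$$ in which $\iota_1,\dots,\iota_4$ are induced by the identity of $R$, $\iota_5$ by the identity of $S$, and $\rho_1,\rho_2$ by the inclusion $R\to S$. The maps $\iota_1,\iota_2,\iota_3,\iota_4$ are surjective and $\rho_1,\rho_2$ are injective. The kernels of $\iota_1,\dots,\iota_5$ are nilpotent ideals. All seven maps induce universal homeomorphisms on spectra (every base change of the induced morphism of schemes is a homeomorphism). Consequently, for every Sylow $p$-subgroup $P$ of $G$, both $\mathrm{Spec}(S^{[G]})$ and $\mathrm{Spec}(S^{\oplus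 G})$ are homeomorphic to $\mathrm{Spec}(S)^P/N_G(P)$, where $\mathrm{Spec}(S)^P\subseteq\mathrm{Spec}(S)$ is the subspace of primes $Q$ such that every element of $P$ maps $Q$ to itself and acts trivially on $S/Q$, and the quotient by the normalizer $N_G(P)$ carries the quotient topology. -/

import Mathlib

open scoped Pointwise

namespace InvariantSummands

universe u v w

noncomputable section

section Invariants

variable (k : Type v) (S : Type u) (G : Type w) [Field k] [CommRing S] [Algebra k S]
  [Group G] [MulSemiringAction G S] [SMulCommClass G k S]

/-- The ring of invariants `R = S^G`. -/
abbrev InvRing : Subalgebra k S := FixedPoints.subalgebra k S G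

/-- The invariants `S^H` of a subgroup `H`. -/
abbrev SubInv (H : Subgroup G) : Subalgebra k S := FixedPoints.subalgebra k S H

/-! ### Transfer -/

variable {k S G}

/-- For `x ∈ S^H`, the element `g • x` depends only on the coset `gH`. -/
def cosetSMul (H : Subgroup G) (x : SubInv k S G H) : G ⧸ H → S :=
  Quotient.lift (fun g : G => g • (x : S)) (by
    intro a b hab
    have hab' : a⁻¹ * b ∈ H := QuotientGroup.leftRel_apply.mp hab
    have h : (a⁻¹ * b) • (x : S) = x := x.2 ⟨_, hab'⟩
    show a • (x : S) = b • (x : S)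
    calc a • (x : S) = a • ((a⁻¹ * b) • (x : S)) := by rw [h]
      _ = b • (x : S) := by rw [smul_smul, mul_inv_cancel_left])

@[simp] theorem cosetSMul_mk (H : Subgroup G) (x : SubInv k S G H) (g : G) :
    cosetSMul H x (g : G ⧸ H) = g • (x : S) := rfl

theorem smul_cosetSMul (H : Subgroup G) (x : SubInv k S G H) (g : G) (c : G ⧸ H) :
    g • cosetSMul H x c = cosetSMul H x (g • c) := by
  induction c using QuotientGroup.induction_on with
  | H a => exact smul_smul g a (x : S)

variable [Finite G]

/-- The transfer `tr_H^G : S^H → S^G`, `x ↦ ∑_{gH ∈ G/H} g x`. -/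
def transfer (H : Subgroup G) (x : SubInv k S G H) : InvRing k S G :=
  let _ := Fintype.ofFinite (G ⧸ H)
  ⟨∑ c : G ⧸ H, cosetSMul H x c, fun g => by
    rw [Finset.smul_sum]
    simp_rw [smul_cosetSMul]
    exact Fintype.sum_equiv (MulAction.toPerm g) _ _ (fun _ => rfl)⟩

/-- The image `tr_H^G(S^H)` of the transfer, which is an ideal of `S^G`. -/
def transferImage (H : Subgroup G) : Ideal (InvRing k S G) where
  carrier := Set.range (transfer (k := k) (S := S) H)
  zero_mem' := by
    refine ⟨0, Subtype.ext ?_⟩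
    let _ := Fintype.ofFinite (G ⧸ H)
    refine Finset.sum_eq_zero fun c _ => ?_
    induction c using QuotientGroup.induction_on with
    | H a => exact smul_zero a
  add_mem' := by
    rintro _ _ ⟨x, rfl⟩ ⟨y, rfl⟩
    refine ⟨x + y, Subtype.ext ?_⟩
    let _ := Fintype.ofFinite (G ⧸ H)
    refine Eq.trans (Finset.sum_congr rfl fun c _ => ?_) Finset.sum_add_distrib
    induction c using QuotientGroup.induction_on with
    | H a => exact smul_add a (x : S) (y : S)
  smul_mem' := by
    rintro r _ ⟨x, rfl⟩
    refine ⟨⟨(r : S) * x, fun h => ?_⟩, Subtype.ext ?_⟩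
    · rw [smul_mul', x.2 h]
      congr 1
      exact r.2 (h : G)
    · let _ := Fintype.ofFinite (G ⧸ H)
      refine Eq.trans (Finset.sum_congr rfl fun c _ => ?_) (Finset.mul_sum _ _ _).symm
      induction c using QuotientGroup.induction_on with
      | H a =>
        have hr : a • (r : S) = r := r.2 a
        show a • ((r : S) * (x : S)) = (r : S) * (a • (x : S))
        rw [smul_mul', hr]

variable (k S)

/-- `T_G(𝒳, S) = ∑_{H ∈ 𝒳} tr_H^G(S^H)`, an ideal of `S^G`. -/
def transferIdeal (𝒳 : Set (Subgroup G)) : Ideal (InvRing k S G) :=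
  ⨆ H ∈ 𝒳, transferImage H

/-- The ideal of `S` generated by `T_G(𝒳, S)`. -/
def extTransferIdeal (𝒳 : Set (Subgroup G)) : Ideal S :=
  (transferIdeal k S 𝒳).map (algebraMap (InvRing k S G) S)

end Invariants

/-! ### Families of `p`-subgroups

Here `p` is the exponential characteristic of the field: the characteristic if that is positive,
and `1` in characteristic zero. `1`-subgroups are trivial, and so is the Sylow `1`-subgroup. -/

/-- The set `Syl_p(G)`. -/
def sylowSet (p : ℕ) (G : Type w) [Group G] : Set (Subgroup G) :=
  {H | ∃ P : Sylow p G, (P : Subgroup G) = H}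

/-- The set `𝒮_p(G) ∖ Syl_p(G)` of `p`-subgroups that are not Sylow. -/
def nonSylowSet (p : ℕ) (G : Type w) [Group G] : Set (Subgroup G) :=
  {H | IsPGroup p H} \ sylowSet p G

section Quotients

variable (k : Type v) (S : Type u) (G : Type w) [Field k] [CommRing S] [Algebra k S]
  [Group G] [MulSemiringAction G S] [SMulCommClass G k S]

/-! ### The Brauer quotient -/

/-- The Brauer quotient `S^{[G]}`: the quotient of `S^G = Hom_{kG}(k, S)` by the sum of the images
of the transfers from the `p`-subgroups of `G` of index divisible by the characteristic of `k`. -/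
abbrev BrauerQuotient [Finite G] : Type u :=
  InvRing k S G ⧸ transferIdeal k S
    {H : Subgroup G | IsPGroup (ringExpChar k) H ∧ ringChar k ∣ H.index}

/-! ### The ring of invariant summands -/

/-- The trivial representation of `G` on `k`. -/
abbrev trivRep : Representation k G k := Representation.trivial k G k

/-- `S` as a representation of `G` over `k`. -/
abbrev ringRep : Representation k G S := Representation.ofDistribMulAction k G S

variable {k S G}

/-- A homomorphism of `kG`-modules is split injective if it has a `kG`-linear left inverse. -/
def IsSplitInjective {M N : Type*} [AddCommGroup M] [Module k M] [AddCommGroup N] [Module k N]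
    {ρ : Representation k G M} {σ : Representation k G N} (f : ρ.IntertwiningMap σ) : Prop :=
  ∃ s : σ.IntertwiningMap ρ, s.comp f = Representation.IntertwiningMap.id ρ

/-- The identification `S^G ≃ Hom_{kG}(k, S)`, under which `r` corresponds to `c ↦ c • r`. -/
def homEquiv : InvRing k S G ≃ (trivRep k G).IntertwiningMap (ringRep k S G) where
  toFun r := LinearMap.intertwiningMap_of_isIntertwiningMap _ _
    (LinearMap.toSpanSingleton k S (r : S)) (fun g c => by
      have hr : g • (r : S) = r := r.2 g
      simp [hr])
  invFun f := ⟨f 1, fun g => by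
    have h := Representation.IntertwiningMap.isIntertwining _ _ f g 1
    simpa using h.symm⟩
  left_inv r := by
    apply Subtype.ext
    exact one_smul k (r : S)
  right_inv f := by
    apply Representation.IntertwiningMap.ext
    apply LinearMap.ext_ring
    exact one_smul k (f 1)

theorem homEquiv_apply (r : InvRing k S G) (c : k) : homEquiv r c = c • (r : S) := rfl

/-- The identification takes the product of `S^G` to the product
`k → k ⊗ k → S ⊗ S → S` on `Hom_{kG}(k, S)`. -/
theorem homEquiv_mul (r t : InvRing k S G) :
    (homEquiv (r * t)).toLinearMap =
      LinearMap.mul' k S ∘ₗ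
        TensorProduct.map (homEquiv r).toLinearMap (homEquiv t).toLinearMap ∘ₗ
          (TensorProduct.lid k k).symm.toLinearMap := by
  apply LinearMap.ext_ring
  have h1 : (homEquiv (r * t)).toLinearMap 1 = (r : S) * t := one_smul k _
  have h2 : (homEquiv r).toLinearMap 1 = (r : S) := one_smul k _
  have h3 : (homEquiv t).toLinearMap 1 = (t : S) := one_smul k _
  simp only [LinearMap.comp_apply, LinearEquiv.coe_coe, TensorProduct.lid_symm_apply,
    TensorProduct.map_tmul, LinearMap.mul'_apply]
  rw [h1, h2, h3]

theorem isSplitInjective_homEquiv_iff (r : InvRing k S G) :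
    IsSplitInjective (homEquiv r) ↔
      ∃ s : (ringRep k S G).IntertwiningMap (trivRep k G), s (r : S) = 1 := by
  constructor
  · rintro ⟨s, hs⟩
    refine ⟨s, ?_⟩
    have h := DFunLike.congr_fun hs (1 : k)
    have h1 : homEquiv r (1 : k) = (r : S) := one_smul k _
    simpa [h1] using h
  · rintro ⟨s, hs⟩
    refine ⟨s, ?_⟩
    apply Representation.IntertwiningMap.ext
    apply LinearMap.ext_ring
    have h1 : homEquiv r (1 : k) = (r : S) := one_smul k _
    show s (homEquiv r (1 : k)) = 1
    rw [h1, hs]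

theorem isSplitInjective_homEquiv_iff' (r : InvRing k S G) :
    IsSplitInjective (homEquiv r) ↔
      ∃ s : (ringRep k S G).IntertwiningMap (trivRep k G), s (r : S) ≠ 0 := by
  rw [isSplitInjective_homEquiv_iff]
  constructor
  · rintro ⟨s, hs⟩
    exact ⟨s, by rw [hs]; exact one_ne_zero⟩
  · rintro ⟨s, hs⟩
    refine ⟨⟨(s (r : S))⁻¹ • s.toLinearMap, fun g => ?_⟩, ?_⟩
    · ext x
      have h := Representation.IntertwiningMap.isIntertwining _ _ s g x
      simp only [LinearMap.comp_apply, LinearMap.smul_apply,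
        Representation.IntertwiningMap.toLinearMap_apply] at h ⊢
      rw [h]
      simp
    · exact inv_mul_cancel₀ hs

variable (k S G)

/-- `J_G(k, S)`: the homomorphisms `k → S` of `kG`-modules that are not split injective,
as an ideal of `S^G = Hom_{kG}(k, S)`. -/
def nonSplitIdeal : Ideal (InvRing k S G) where
  carrier := {r | ¬ IsSplitInjective (homEquiv r)}
  zero_mem' := by
    rw [Set.mem_ofPred_eq, isSplitInjective_homEquiv_iff']
    rintro ⟨s, hs⟩
    exact hs (map_zero s)
  add_mem' := by
    intro a b ha hb
    rw [Set.mem_ofPred_eq, isSplitInjective_homEquiv_iff'] at *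
    push Not at *
    intro s
    have h : s ((a : S) + (b : S)) = s (a : S) + s (b : S) := map_add s _ _
    rw [ha s, hb s, add_zero] at h
    exact h
  smul_mem' := by
    intro c a ha
    rw [Set.mem_ofPred_eq, isSplitInjective_homEquiv_iff'] at *
    push Not at *
    intro s
    have h := ha ⟨s.toLinearMap ∘ₗ LinearMap.mulLeft k (c : S), fun g => by
      ext x
      have hc : g • (c : S) = c := c.2 g
      have h := Representation.IntertwiningMap.isIntertwining _ _ s g ((c : S) * x)
      simp only [Representation.ofDistribMulAction_apply_apply, smul_mul', hc] at h
      simpa using h⟩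
    exact h

/-- The ring of invariant summands `S^{⊕G} = Hom_{kG}(k, S) / J_G(k, S)`. -/
abbrev InvariantSummandRing : Type u := InvRing k S G ⧸ nonSplitIdeal k S G

end Quotients

/-! ### Fixed points -/

section FixedPoints

variable (S : Type u) {G : Type w} [CommRing S] [Group G] [MulSemiringAction G S]

/-- `I(H, S)`: the ideal of `S` generated by the elements `(h - 1) s`, `h ∈ H`, `s ∈ S`. -/
def fixedIdeal (H : Subgroup G) : Ideal S :=
  Ideal.span {x | ∃ h ∈ H, ∃ s : S, x = h • s - s}

/-- `I(𝒴, S) = ⋂_{H ∈ 𝒴} I(H, S)`. -/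
def fixedIdealInter (𝒴 : Set (Subgroup G)) : Ideal S :=
  ⨅ H ∈ 𝒴, fixedIdeal S H

/-- `Spec(S)^H`: the primes `Q` such that every `h ∈ H` maps `Q` to itself and acts trivially on
`S/Q`. The condition `h s - s ∈ Q` for all `s` says both. -/
abbrev FixedSpectrum (H : Subgroup G) : Type u :=
  {Q : PrimeSpectrum S // ∀ h ∈ H, ∀ s : S, h • s - s ∈ Q.asIdeal}

/-- The orbit relation on `Spec(S)^H` of the action of the normalizer `N_G(H)`. -/
def normalizerRel (H : Subgroup G) : Setoid (FixedSpectrum S H) where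
  r Q Q' := ∃ g ∈ Subgroup.normalizer (H : Set G), g • Q.1.asIdeal = Q'.1.asIdeal
  iseqv :=
    { refl := fun Q => ⟨1, one_mem _, one_smul _ _⟩
      symm := by
        rintro Q Q' ⟨g, hg, h⟩
        exact ⟨g⁻¹, inv_mem hg, by rw [← h, inv_smul_smul]⟩
      trans := by
        rintro Q Q' Q'' ⟨g, hg, h⟩ ⟨g', hg', h'⟩
        exact ⟨g' * g, mul_mem hg' hg, by rw [mul_smul, h, h']⟩ }

/-- The space `Spec(S)^H / N_G(H)` with the quotient topology. -/
abbrev FixedSpectrumQuotient (H : Subgroup G) : Type u := Quotient (normalizerRel S H)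

variable {S}

/-- An ideal that is carried into itself by every element of `G`. -/
def IsStable (G : Type w) [Group G] [MulSemiringAction G S] (J : Ideal S) : Prop :=
  ∀ g : G, J ≤ J.comap (MulSemiringAction.toRingHom G S g)

/-- `(S/J)^G` for a `G`-stable ideal `J`: the elements of `S/J` fixed by the action induced by
every `g ∈ G`. -/
def quotientInvariants {J : Ideal S} (hJ : IsStable G J) : Subring (S ⧸ J) :=
  ⨅ g : G, RingHom.eqLocus (Ideal.quotientMap J (MulSemiringAction.toRingHom G S g) (hJ g))
    (RingHom.id (S ⧸ J))

theorem mk_mem_quotientInvariants {J : Ideal S} (hJ : IsStable G J) (s : S) :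
    Ideal.Quotient.mk J s ∈ quotientInvariants hJ ↔ ∀ g : G, g • s - s ∈ J := by
  simp only [quotientInvariants, Subring.mem_iInf, RingHom.mem_eqLocus, Ideal.quotientMap_mk,
    RingHom.id_apply, Ideal.Quotient.eq, MulSemiringAction.toRingHom_apply]

theorem isStable_extTransferIdeal (k : Type v) [Field k] [Algebra k S] [SMulCommClass G k S]
    [Finite G] (𝒳 : Set (Subgroup G)) : IsStable G (extTransferIdeal k S 𝒳) := by
  intro g
  rw [extTransferIdeal, Ideal.map_le_iff_le_comap]
  intro t ht
  rw [Ideal.mem_comap, Ideal.mem_comap]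
  have h : MulSemiringAction.toRingHom G S g (algebraMap (InvRing k S G) S t) =
      algebraMap (InvRing k S G) S t := t.2 g
  rw [h]
  exact Ideal.mem_map_of_mem _ ht

theorem isStable_fixedIdealInter_sylow (p : ℕ) :
    IsStable G (fixedIdealInter S (sylowSet p G)) := by
  intro g x hx
  rw [Ideal.mem_comap]
  simp only [fixedIdealInter, Ideal.mem_iInf] at hx ⊢
  rintro _ ⟨P, rfl⟩
  have h1 := hx _ ⟨g⁻¹ • P, rfl⟩
  have h2 : fixedIdeal S ((g⁻¹ • P : Sylow p G) : Subgroup G) ≤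
      (fixedIdeal S (P : Subgroup G)).comap (MulSemiringAction.toRingHom G S g) := by
    rw [fixedIdeal, Ideal.span_le]
    rintro _ ⟨h, hh, s, rfl⟩
    refine Ideal.subset_span ⟨g * h * g⁻¹, ?_, g • s, ?_⟩
    · rw [Sylow.coe_subgroup_smul] at hh
      have := Subgroup.mem_pointwise_smul_iff_inv_smul_mem.mp hh
      simpa [MulAut.smul_def] using this
    · simp [smul_smul, smul_sub]
  exact h2 h1

end FixedPoints

/-! ### The ideals and rings of invariants in the diagram -/

section Diagram

variable (k : Type v) (S : Type u) (G : Type w) [Field k] [CommRing S] [Algebra k S]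
  [Group G] [MulSemiringAction G S] [SMulCommClass G k S]

/-- `ST`: the ideal of `S` generated by `T = T_G(𝒮_p(G) ∖ Syl_p(G), S)`. -/
abbrev idealST [Finite G] (p : ℕ) : Ideal S := extTransferIdeal k S (nonSylowSet p G)

/-- `I = I(Syl_p(G), S)`. -/
abbrev idealI (p : ℕ) : Ideal S := fixedIdealInter S (sylowSet p G)

/-- `R ∩ ST`, where `R = S^G`. -/
abbrev idealRST [Finite G] (p : ℕ) : Ideal (InvRing k S G) :=
  (idealST k S G p).comap (algebraMap (InvRing k S G) S)

/-- `R ∩ I`, where `R = S^G`. -/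
abbrev idealRI (p : ℕ) : Ideal (InvRing k S G) :=
  (idealI S G p).comap (algebraMap (InvRing k S G) S)

/-- `(S/ST)^G`. -/
abbrev invModST [Finite G] (p : ℕ) : Subring (S ⧸ idealST k S G p) :=
  quotientInvariants (isStable_extTransferIdeal k (nonSylowSet p G))

/-- `(S/I)^G`. -/
abbrev invModI (p : ℕ) : Subring (S ⧸ idealI S G p) :=
  quotientInvariants (isStable_fixedIdealInter_sylow (G := G) p)

end Diagram

/-! ### Universal homeomorphisms -/

/-- A ring homomorphism induces a universal homeomorphism on spectra: every base change of the
morphism of schemes `Spec B → Spec A` is a homeomorphism on underlying spaces. -/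
def InducesUniversalHomeomorphism {A B : Type u} [CommRing A] [CommRing B] (f : A →+* B) : Prop :=
  (AlgebraicGeometry.topologically @IsHomeomorph).universally
    (AlgebraicGeometry.Spec.map (CommRingCat.ofHom f))

end

end InvariantSummands

/-!
The seven homomorphisms are the evident ones; everything rests on comparing the ideals
`T ⊆ J ⊆ R ∩ I` and `T ⊆ R ∩ ST ⊆ R ∩ I`, where `J` is the ideal of non-split homomorphisms. An
intertwining map `S → k` multiplies by `[G : H]` on transfers from `H`, so `T ⊆ J`
(`transferIdeal_le_nonSplitIdeal`). An invariant outside `I(P, S)` is detected by a `P`-invariant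
linear form, and averaging that form over `G/P` splits the invariant, so `J ⊆ I`
(`nonSplitIdeal_le_idealRI`).

All these ideals have the same radical. The reason is `exists_sylow_le_inertia`: a prime `Q` of `S`
that contains `T` has a Sylow `p`-subgroup `P` of `G` in its inertia group, that is,
`I(P, S) ⊆ Q`. For this, let `H` be a Sylow `p`-subgroup of the inertia group `E` of `Q`. Modulo `Q`,
the transfers of the norms `∏_{h ∈ H} h s` are the values of a sum of multiplicative characters
`S → S/Q` indexed by `G/H`, in which the character of the coset `H` occurs `[E : H]` times, a number
prime to `p`. By Dedekind's independence of characters some transfer from `H` is not in `Q`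
(`exists_transfer_notMem`), so `H` has to be a Sylow subgroup of `G`. Since `R` and `S` are
noetherian and `S` is integral over `R`, all the kernels are nilpotent.

For a stable ideal `𝔞`, an invariant of `S/𝔞` has a `p`-power that comes from `R`: take the norm over
a Sylow subgroup `P`, then the transfer from `P`, and divide by `[G : P]`
(`exists_invariant_sub_mem`). Ring homomorphisms with nil kernel whose target has this property
over their image induce universal homeomorphisms
(`inducesUniversalHomeomorphism_of_pow_mem_range`).

Contraction of primes maps `Spec(S)^P` onto the closed set of primes of `R` that contain `T`. It is a
closed map as `S` is integral over `R`, and its fibres are the orbits of `N_G(P)` by Sylow's theorem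
in inertia groups. This gives the two homeomorphisms
(`nonempty_homeomorph_fixedSpectrumQuotient`).
-/

namespace InvariantSummands

/-! ### Sylow subgroups at the exponential characteristic -/

theorem eq_bot_of_isPGroup_one {G : Type*} [Group G] {H : Subgroup G} (hH : IsPGroup 1 H) :
    H = ⊥ := by
  rw [Subgroup.eq_bot_iff_forall]
  intro g hg
  obtain ⟨n, hn⟩ := hH ⟨g, hg⟩
  simpa using hn

theorem charP_of_expChar_of_prime {k : Type*} [Field k] {p : ℕ} [h : ExpChar k p]
    (hp : p.Prime) : CharP k p := by
  cases h with
  | zero => exact absurd hp Nat.not_prime_one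
  | prime _ => assumption

theorem exists_card_eq_pow_of_isPGroup (k : Type*) [Field k] (p : ℕ) [ExpChar k p]
    {G : Type*} [Group G] [Finite G] {H : Subgroup G} (hH : IsPGroup p H) :
    ∃ n, Nat.card H = p ^ n := by
  obtain hp | rfl := expChar_is_prime_or_one k p
  · have : Fact p.Prime := ⟨hp⟩
    exact IsPGroup.iff_card.mp hH
  · exact ⟨0, by simp [eq_bot_of_isPGroup_one hH]⟩

theorem sylow_index_cast_ne_zero (k : Type*) [Field k] {p : ℕ} [ExpChar k p]
    {G : Type*} [Group G] [Finite G] (P : Sylow p G) :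
    ((P : Subgroup G).index : k) ≠ 0 := by
  obtain hp | rfl := expChar_is_prime_or_one k p
  · have : Fact p.Prime := ⟨hp⟩
    have : CharP k p := charP_of_expChar_of_prime hp
    rw [Ne, CharP.cast_eq_zero_iff k p]
    exact P.not_dvd_index
  · have : CharZero k := charZero_of_expChar_one' k
    exact Nat.cast_ne_zero.mpr Subgroup.index_ne_zero_of_finite

/-- Sylow's conjugacy theorem, including characteristic zero, where `p = 1`. -/
theorem exists_smul_sylow_eq (k : Type*) [Field k] {p : ℕ} [ExpChar k p]
    {G : Type*} [Group G] [Finite G] (P P' : Sylow p G) : ∃ g : G, g • P = P' := by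
  obtain hp | rfl := expChar_is_prime_or_one k p
  · have : Fact p.Prime := ⟨hp⟩
    exact MulAction.exists_smul_eq G P P'
  · exact ⟨1, Sylow.ext
      ((eq_bot_of_isPGroup_one (1 • P).2).trans (eq_bot_of_isPGroup_one P'.2).symm)⟩

/-- A `p`-subgroup is a Sylow subgroup exactly if its index is invertible in `k`. In
characteristic zero both conditions hold for the trivial subgroup, the only `1`-subgroup. -/
theorem setOf_isPGroup_and_dvd_index (k : Type*) [Field k] (p : ℕ) [ExpChar k p]
    (G : Type*) [Group G] [Finite G] :
    {H : Subgroup G | IsPGroup (ringExpChar k) H ∧ ringChar k ∣ H.index} = nonSylowSet p G := by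
  ext H
  rw [ringExpChar.eq k p]
  refine and_congr_right fun hH => ?_
  rw [← ringChar.spec k]
  constructor
  · rintro h ⟨P, rfl⟩
    exact sylow_index_cast_ne_zero k P h
  · intro h
    by_contra hne
    refine h ?_
    obtain hp | rfl := expChar_is_prime_or_one k p
    · have : Fact p.Prime := ⟨hp⟩
      have : CharP k p := charP_of_expChar_of_prime hp
      rw [CharP.cast_eq_zero_iff k p] at hne
      exact ⟨hH.toSylow hne, rfl⟩
    · obtain ⟨P, -⟩ := hH.exists_le_sylow
      exact ⟨P, (eq_bot_of_isPGroup_one P.2).trans (eq_bot_of_isPGroup_one hH).symm⟩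

/-! ### Norms and transfers -/

section Norm

variable (k : Type*) {S G : Type*} [Field k] [CommRing S] [Algebra k S]
  [Group G] [Finite G] [MulSemiringAction G S] [SMulCommClass G k S]

/-- The norm `s ↦ ∏_{h ∈ H} h s` from `S` to the invariants `S^H`. -/
noncomputable def subgroupNorm (H : Subgroup G) : S →* SubInv k S G H :=
  let _ := Fintype.ofFinite H
  { toFun := fun s => ⟨∏ h : H, h • s, fun h => by
      rw [Finset.smul_prod']
      simp_rw [smul_smul]
      exact Fintype.prod_equiv (Equiv.mulLeft h) _ _ (fun _ => rfl)⟩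
    map_one' := Subtype.ext (by simp)
    map_mul' := fun s t => Subtype.ext (by simp [smul_mul', Finset.prod_mul_distrib]) }

theorem mk_smul_subgroupNorm (H : Subgroup G) (J : Ideal S) (g : G) (s : S) {t : S ⧸ J}
    (h : ∀ h ∈ H, Ideal.Quotient.mk J (g • h • s) = t) :
    Ideal.Quotient.mk J (g • (subgroupNorm k H s : S)) = t ^ Nat.card H := by
  let _ := Fintype.ofFinite H
  have h1 : (subgroupNorm k H s : S) = ∏ h : H, h • s := rfl
  have h2 (x : H) : Ideal.Quotient.mk J (g • x • s) = t := h x x.2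
  rw [h1, Finset.smul_prod', map_prod]
  simp_rw [h2]
  rw [Finset.prod_const, Finset.card_univ, Nat.card_eq_fintype_card]

variable {k}

theorem coe_transfer (H : Subgroup G) [Fintype (G ⧸ H)] (x : SubInv k S G H) :
    (transfer H x : S) = ∑ c : G ⧸ H, cosetSMul H x c := by
  obtain rfl := Subsingleton.elim (Fintype.ofFinite (G ⧸ H)) ‹_›
  rfl

theorem coe_mem_of_transferIdeal_le {J : Ideal S} {𝒳 : Set (Subgroup G)}
    (h : transferIdeal k S 𝒳 ≤ J.comap (algebraMap (InvRing k S G) S)) {H : Subgroup G}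
    (hH : H ∈ 𝒳) (x : SubInv k S G H) : (transfer H x : S) ∈ J :=
  h ((le_iSup₂_of_le H hH le_rfl : transferImage H ≤ transferIdeal k S 𝒳) ⟨x, rfl⟩)

/-- An invariant of `S/J`, for a stable ideal `J`, becomes the image of an invariant of `S` after
raising it to the order `p^n` of a Sylow `p`-subgroup `P`: modulo `J` the transfer from `P` of its
norm is `[G : P]` times that power. -/
theorem exists_invariant_sub_mem (p : ℕ) [ExpChar k p] {J : Ideal S} {s : S}
    (hs : ∀ g : G, g • s - s ∈ J) :
    ∃ (n : ℕ) (r : InvRing k S G),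
      Ideal.Quotient.mk J (r : S) = Ideal.Quotient.mk J s ^ p ^ n := by
  obtain ⟨P⟩ : Nonempty (Sylow p G) := inferInstance
  obtain ⟨n, hn⟩ := exists_card_eq_pow_of_isPGroup k p P.2
  let _ := Fintype.ofFinite (G ⧸ (P : Subgroup G))
  have hs' : ∀ g : G, Ideal.Quotient.mk J (g • s) = Ideal.Quotient.mk J s :=
    fun g => Ideal.Quotient.eq.mpr (hs g)
  have htr : Ideal.Quotient.mk J (transfer (P : Subgroup G) (subgroupNorm k (P : Subgroup G) s) : S) =
      ((P : Subgroup G).index : k) • Ideal.Quotient.mk J s ^ p ^ n := by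
    rw [coe_transfer, map_sum, Finset.sum_congr rfl (g := fun _ => Ideal.Quotient.mk J s ^ p ^ n)]
    · rw [Finset.sum_const, Finset.card_univ, ← Nat.card_eq_fintype_card, Nat.cast_smul_eq_nsmul]
      rfl
    · intro c _
      induction c using QuotientGroup.induction_on with
      | H g =>
        rw [cosetSMul_mk, ← hn]
        refine mk_smul_subgroupNorm k (P : Subgroup G) J g s fun h _ => ?_
        rw [smul_smul, hs']
  refine ⟨n, ((P : Subgroup G).index : k)⁻¹ •
    transfer (P : Subgroup G) (subgroupNorm k (P : Subgroup G) s), ?_⟩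
  change Ideal.Quotient.mkₐ k J
    (((P : Subgroup G).index : k)⁻¹ •
      (transfer (P : Subgroup G) (subgroupNorm k (P : Subgroup G) s) : S)) = _
  rw [map_smul]
  change _ • Ideal.Quotient.mk J _ = _
  rw [htr, smul_smul, inv_mul_cancel₀ (sylow_index_cast_ne_zero k P), one_smul]

end Norm

/-! ### Primes containing the transfers -/

section Inertia

variable {k S G : Type*} [Field k] [CommRing S] [Algebra k S]
  [Group G] [MulSemiringAction G S] [SMulCommClass G k S]

theorem mk_smul_of_mem_inertia {Q : Ideal S} {h : G} (hh : h ∈ Q.inertia G) (s : S) :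
    Ideal.Quotient.mk Q (h • s) = Ideal.Quotient.mk Q s :=
  Ideal.Quotient.eq.mpr (hh s)

theorem fixedIdeal_le_iff {H : Subgroup G} {Q : Ideal S} :
    fixedIdeal S H ≤ Q ↔ H ≤ Q.inertia G := by
  rw [fixedIdeal, Ideal.span_le]
  constructor
  · exact fun h g hg s => h ⟨g, hg, s, rfl⟩
  · rintro h _ ⟨g, hg, s, rfl⟩
    exact h hg s

theorem fixedIdealInter_sylowSet_le {p : ℕ} (P : Sylow p G) :
    fixedIdealInter S (sylowSet p G) ≤ fixedIdeal S (P : Subgroup G) :=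
  iInf₂_le _ ⟨P, rfl⟩

variable [Finite G]

/-- For a coset `c = gH`, the multiplicative map `S → S/Q`, `s ↦ ∏_{h ∈ H} g h s`. -/
noncomputable def cosetNorm (k : Type*) [Field k] [Algebra k S] [SMulCommClass G k S]
    (Q : Ideal S) (H : Subgroup G) (c : G ⧸ H) : S →* S ⧸ Q where
  toFun s := Ideal.Quotient.mk Q (cosetSMul H (subgroupNorm k H s) c)
  map_one' := by
    induction c using QuotientGroup.induction_on with
    | H g => simp
  map_mul' s t := by
    induction c using QuotientGroup.induction_on with
    | H g => simp [smul_mul']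

/-- The map `s ↦ ∏_{h ∈ H} g h s` modulo `Q` determines whether `g` lies in the inertia group of
`Q`: if it is `s ↦ s^{|H|}`, then `g` fixes `Q`, so that `(g s)^{|H|} = s^{|H|}` in the domain
`S/Q`, where the `p`-power map is injective. -/
theorem cosetNorm_eq_cosetNorm_one_iff (p : ℕ) [ExpChar k p] {Q : Ideal S} [Q.IsPrime]
    {H : Subgroup G} (hHQ : H ≤ Q.inertia G) (hH : IsPGroup p H) (g : G) :
    cosetNorm k Q H (g : G ⧸ H) = cosetNorm k Q H ((1 : G) : G ⧸ H) ↔ g ∈ Q.inertia G := by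
  have hone (s : S) : cosetNorm k Q H ((1 : G) : G ⧸ H) s =
      Ideal.Quotient.mk Q s ^ Nat.card H := by
    refine mk_smul_subgroupNorm k H Q 1 s fun h hh => ?_
    rw [one_smul, mk_smul_of_mem_inertia (hHQ hh)]
  have hstab (hg : g • Q = Q) (s : S) : cosetNorm k Q H (g : G ⧸ H) s =
      Ideal.Quotient.mk Q (g • s) ^ Nat.card H := by
    refine mk_smul_subgroupNorm k H Q g s fun h hh => ?_
    rw [Ideal.Quotient.eq, ← smul_sub, ← hg]
    exact Ideal.smul_mem_pointwise_smul _ _ _ (hHQ hh s)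
  constructor
  · intro heq
    -- If `g s ∈ Q`, the factor of `h = 1` puts the product, which is `s^{|H|}`, into `Q`.
    have hle : g⁻¹ • Q ≤ Q := by
      intro s hs
      rw [Ideal.mem_inv_pointwise_smul_iff] at hs
      let _ := Fintype.ofFinite H
      have h0 : cosetNorm k Q H (g : G ⧸ H) s = 0 := by
        refine Ideal.Quotient.eq_zero_iff_mem.mpr ?_
        have h1 : (subgroupNorm k H s : S) = ∏ h : H, h • s := rfl
        rw [cosetSMul_mk, h1, Finset.smul_prod']
        refine Ideal.mem_of_dvd Q (Finset.dvd_prod_of_mem _ (Finset.mem_univ (1 : H))) ?_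
        rwa [one_smul]
      rw [heq, hone] at h0
      exact Ideal.Quotient.eq_zero_iff_mem.mp (pow_eq_zero_iff Nat.card_pos.ne' |>.mp h0)
    have hg : g • Q = Q := by
      have h1 : Q ≤ g • Q := by simpa using smul_mono_right g hle
      exact (smul_eq_of_le_smul h1)
    intro s
    obtain ⟨n, hn⟩ := exists_card_eq_pow_of_isPGroup k p hH
    have h2 := hstab hg s
    rw [heq, hone, hn] at h2
    have : ExpChar (S ⧸ Q) p := expChar_of_injective_algebraMap (algebraMap k (S ⧸ Q)).injective p
    exact Ideal.Quotient.eq.mp (iterateFrobenius_inj (S ⧸ Q) p n h2).symm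
  · intro hg
    ext s
    rw [hstab (Ideal.inertia_le_stabilizer Q hg), hone, mk_smul_of_mem_inertia hg]

/-- The multiplicity of the character of the coset `H` among the characters of `G/H`. -/
theorem card_cosetNorm_eq (p : ℕ) [ExpChar k p] {Q : Ideal S} [Q.IsPrime]
    {H : Subgroup G} (hHQ : H ≤ Q.inertia G) (hH : IsPGroup p H) :
    Nat.card {c : G ⧸ H // cosetNorm k Q H c = cosetNorm k Q H ((1 : G) : G ⧸ H)} =
      H.relIndex (Q.inertia G) := by
  symm
  let f : Q.inertia G ⧸ H.subgroupOf (Q.inertia G) → G ⧸ H :=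
    Quotient.map' (fun g => (g : G)) fun a b hab => by
      rw [QuotientGroup.leftRel_apply] at hab ⊢
      exact hab
  have hf (g : Q.inertia G) : f (g : Q.inertia G ⧸ H.subgroupOf (Q.inertia G)) = ((g : G) : G ⧸ H) :=
    rfl
  refine Nat.card_congr (Equiv.ofBijective (fun c => ⟨f c, ?_⟩) ⟨?_, ?_⟩)
  · induction c using QuotientGroup.induction_on with
    | H g => exact (cosetNorm_eq_cosetNorm_one_iff p hHQ hH g).mpr g.2
  · intro a b hab
    induction a using QuotientGroup.induction_on with
    | H a =>
    induction b using QuotientGroup.induction_on with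
    | H b =>
      have h := congrArg Subtype.val hab
      simp only [hf, QuotientGroup.eq] at h
      exact QuotientGroup.eq.mpr h
  · rintro ⟨c, hc⟩
    induction c using QuotientGroup.induction_on with
    | H g => exact ⟨((⟨g, (cosetNorm_eq_cosetNorm_one_iff p hHQ hH g).mp hc⟩ : Q.inertia G) :
        Q.inertia G ⧸ H.subgroupOf (Q.inertia G)), rfl⟩

/-- If `H` is a `p`-subgroup of the inertia group of `Q` of index prime to `p` in it, then some
transfer from `H` is not in `Q`. The transfers of norms are, modulo `Q`, the values of a sum of
characters `S → S/Q`, in which the character of the coset `H` has that index as its multiplicity;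
by the linear independence of characters the sum is not zero. -/
theorem exists_transfer_notMem (p : ℕ) [ExpChar k p] {Q : Ideal S} [Q.IsPrime]
    {H : Subgroup G} (hHQ : H ≤ Q.inertia G) (hH : IsPGroup p H)
    (hidx : (H.relIndex (Q.inertia G) : k) ≠ 0) :
    ∃ x : SubInv k S G H, (transfer H x : S) ∉ Q := by
  classical
  by_contra! hall
  let _ := Fintype.ofFinite (G ⧸ H)
  have hsum : ∑ c : G ⧸ H, (cosetNorm k Q H c : S → S ⧸ Q) = 0 := by
    funext s
    have h := Ideal.Quotient.eq_zero_iff_mem.mpr (hall (subgroupNorm k H s))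
    rw [coe_transfer, map_sum] at h
    rw [Finset.sum_apply]
    exact h
  rw [Finset.sum_comp (fun χ : S →* S ⧸ Q => (χ : S → S ⧸ Q)) (cosetNorm k Q H)] at hsum
  simp_rw [← Nat.cast_smul_eq_nsmul (S ⧸ Q)] at hsum
  have h0 := linearIndependent_iff'.mp (linearIndependent_monoidHom S (S ⧸ Q)) _ _ hsum
    (cosetNorm k Q H ((1 : G) : G ⧸ H)) (Finset.mem_image_of_mem _ (Finset.mem_univ _))
  rw [← Fintype.card_subtype, ← Nat.card_eq_fintype_card, card_cosetNorm_eq p hHQ hH,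
    ← map_natCast (algebraMap k (S ⧸ Q)), map_eq_zero] at h0
  exact hidx h0

/-- A prime ideal that contains all transfers from `p`-subgroups that are not Sylow subgroups has
a Sylow `p`-subgroup of `G` in its inertia group. -/
theorem exists_sylow_le_inertia (p : ℕ) [ExpChar k p] {Q : Ideal S} [Q.IsPrime]
    (hQ : transferIdeal k S (nonSylowSet p G) ≤ Q.comap (algebraMap (InvRing k S G) S)) :
    ∃ P : Sylow p G, (P : Subgroup G) ≤ Q.inertia G := by
  obtain ⟨P⟩ : Nonempty (Sylow p (Q.inertia G)) := inferInstance
  have hHQ : (P : Subgroup (Q.inertia G)).map (Q.inertia G).subtype ≤ Q.inertia G :=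
    Subgroup.map_subtype_le _
  have hH : IsPGroup p ((P : Subgroup (Q.inertia G)).map (Q.inertia G).subtype) := P.2.map _
  obtain ⟨x, hx⟩ := exists_transfer_notMem (k := k) p hHQ hH (by
    rw [Subgroup.relIndex, Subgroup.subgroupOf,
      Subgroup.comap_map_eq_self_of_injective (Subgroup.subtype_injective _)]
    exact sylow_index_cast_ne_zero k P)
  by_contra! hno
  exact hx (coe_mem_of_transferIdeal_le hQ ⟨hH, fun ⟨P', hP'⟩ => hno P' (hP' ▸ hHQ)⟩ x)

end Inertia

/-! ### A criterion for universal homeomorphisms -/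

section UniversalHomeomorphism

open AlgebraicGeometry CategoryTheory

universe u

/-- A ring homomorphism with nil kernel, such that each element of the target has a power with
exponent a power of the exponential characteristic in the image, induces a universal
homeomorphism. It is integral, hence universally closed, and surjective on spectra; two
homomorphisms from the target to a field that agree on the source are equal, because the `p`-power
map of a field is injective, so the morphism is universally injective. -/
theorem inducesUniversalHomeomorphism_of_pow_mem_range {k : Type*} [Field k] (p : ℕ) [ExpChar k p]
    {A B : Type u} [CommRing A] [CommRing B] (φ : k →+* A) (f : A →+* B)
    (hker : RingHom.ker f ≤ nilradical A) (hpow : ∀ b : B, ∃ n : ℕ, b ^ p ^ n ∈ f.range) :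
    InducesUniversalHomeomorphism f := by
  have hp : 0 < p := expChar_pos k p
  have hint : f.IsIntegral := fun b => by
    obtain ⟨n, a, ha⟩ := hpow b
    let _ := f.toAlgebra
    exact IsIntegral.of_pow (R := A) (pow_pos hp n) (ha ▸ isIntegral_algebraMap)
  have hhomeo : IsHomeomorph (PrimeSpectrum.comap f) :=
    PrimeSpectrum.isHomeomorph_comap f (fun b =>
      have ⟨n, hn⟩ := hpow b
      ⟨p ^ n, pow_pos hp n, hn⟩) hker
  have : IsIntegralHom (Spec.map (CommRingCat.ofHom f)) := IsIntegralHom.SpecMap_iff.mpr hint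
  have : Surjective (Spec.map (CommRingCat.ofHom f)) := ⟨hhomeo.surjective⟩
  have : UniversallyInjective (Spec.map (CommRingCat.ofHom f)) := by
    refine ((tfae_universallyInjective _).out 0 1).mpr ?_
    intro K _ g₁ g₂ hg
    obtain ⟨ψ₁, rfl⟩ := Spec.map_surjective g₁
    obtain ⟨ψ₂, rfl⟩ := Spec.map_surjective g₂
    have hψ : (CommRingCat.ofHom f ≫ ψ₁) = CommRingCat.ofHom f ≫ ψ₂ := by
      apply Spec.map_injective
      simpa only [Spec.map_comp] using hg
    have hψ' (a : A) : ψ₁.hom (f a) = ψ₂.hom (f a) :=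
      congr($(congrArg CommRingCat.Hom.hom hψ) a)
    have : ExpChar K p :=
      expChar_of_injective_ringHom ((ψ₁.hom.comp (f.comp φ)).injective) p
    congr 1
    ext b
    obtain ⟨n, a, ha⟩ := hpow b
    refine iterateFrobenius_inj K p n ?_
    simp only [iterateFrobenius_def]
    rw [← map_pow, ← map_pow]
    change ψ₁.hom _ = ψ₂.hom _
    rw [← ha, hψ']
  intro X Y i₁ i₂ f' h
  have h1 : UniversallyClosed f' := MorphismProperty.of_isPullback h.flip inferInstance
  have h2 : Surjective f' := MorphismProperty.of_isPullback h.flip ‹_›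
  have h3 : UniversallyInjective f' := MorphismProperty.of_isPullback h.flip ‹_›
  exact isHomeomorph_iff_continuous_isClosedMap_bijective.mpr
    ⟨f'.continuous, f'.isClosedMap, f'.injective, f'.surjective⟩

end UniversalHomeomorphism

/-! ### The ideals of the diagram -/

section Ideals

variable {k S G : Type*} [Field k] [CommRing S] [Algebra k S]
  [Group G] [MulSemiringAction G S] [SMulCommClass G k S]

theorem mem_nonSplitIdeal_iff (r : InvRing k S G) :
    r ∈ nonSplitIdeal k S G ↔
      ∀ s : (ringRep k S G).IntertwiningMap (trivRep k G), s (r : S) = 0 := by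
  change ¬ _ ↔ _
  rw [isSplitInjective_homEquiv_iff']
  push Not
  rfl

theorem intertwiningMap_smul (f : (ringRep k S G).IntertwiningMap (trivRep k G)) (g : G) (x : S) :
    f (g • x) = f x := by
  simpa using Representation.IntertwiningMap.isIntertwining _ _ f g x

instance isInvariant_invRing : Algebra.IsInvariant (InvRing k S G) S G :=
  ⟨fun b hb => ⟨⟨b, hb⟩, rfl⟩⟩

variable [Finite G]

/-- An intertwining map `S → k` multiplies by `[G : H]` when it is applied to transfers
from `H`. -/
theorem transferIdeal_le_nonSplitIdeal (p : ℕ) [ExpChar k p] :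
    transferIdeal k S (nonSylowSet p G) ≤ nonSplitIdeal k S G := by
  rw [← setOf_isPGroup_and_dvd_index k p G]
  refine iSup₂_le ?_
  rintro H ⟨-, hH⟩ _ ⟨x, rfl⟩
  rw [mem_nonSplitIdeal_iff]
  intro f
  let _ := Fintype.ofFinite (G ⧸ H)
  rw [coe_transfer, map_sum, Finset.sum_congr rfl (g := fun _ => f (x : S))]
  · rw [Finset.sum_const, Finset.card_univ, ← Nat.card_eq_fintype_card, ← Nat.cast_smul_eq_nsmul k]
    change ((H.index : ℕ) : k) • _ = _
    rw [(ringChar.spec k _).mpr hH, zero_smul]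
  · intro c _
    induction c using QuotientGroup.induction_on with
    | H g => rw [cosetSMul_mk, intertwiningMap_smul]

/-- If an invariant `r` is not in `I(P, S)`, some `P`-invariant linear form on `S` is nonzero
at `r`. Its average over `G/P` takes `r` to `[G : P]` times that value and splits `r`. -/
theorem nonSplitIdeal_le_idealRI (p : ℕ) [ExpChar k p] :
    nonSplitIdeal k S G ≤ idealRI k S G p := by
  intro r hr
  rw [mem_nonSplitIdeal_iff] at hr
  simp only [Ideal.mem_comap, fixedIdealInter, Ideal.mem_iInf]
  rintro _ ⟨P, rfl⟩
  rw [← Ideal.Quotient.eq_zero_iff_mem, ← Module.forall_dual_apply_eq_zero_iff k]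
  intro φ
  let _ := Fintype.ofFinite (G ⧸ (P : Subgroup G))
  let D (c : G ⧸ (P : Subgroup G)) : S →ₗ[k] k :=
    φ ∘ₗ (Ideal.Quotient.mkₐ k (fixedIdeal S (P : Subgroup G))).toLinearMap ∘ₗ
      DistribSMul.toLinearMap k S c.out⁻¹
  have hD (g : G) (x : S) : D (g : G ⧸ (P : Subgroup G)) x =
      φ (Ideal.Quotient.mk (fixedIdeal S (P : Subgroup G)) (g⁻¹ • x)) := by
    change φ (Ideal.Quotient.mk _ ((g : G ⧸ (P : Subgroup G)).out⁻¹ • x)) = _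
    congr 1
    obtain ⟨h, hh⟩ := QuotientGroup.mk_out_eq_mul (P : Subgroup G) g
    rw [hh, mul_inv_rev, mul_smul, Ideal.Quotient.eq]
    exact Ideal.subset_span ⟨_, inv_mem h.2, g⁻¹ • x, rfl⟩
  have hDsmul (g : G) (c : G ⧸ (P : Subgroup G)) (x : S) : D c (g • x) = D (g⁻¹ • c) x := by
    induction c using QuotientGroup.induction_on with
    | H a =>
      rw [hD, smul_smul]
      change _ = D ((g⁻¹ * a : G) : G ⧸ (P : Subgroup G)) x
      rw [hD, mul_inv_rev, inv_inv]
  have h := hr ⟨∑ c, D c, fun g => by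
    ext x
    simp only [LinearMap.comp_apply, LinearMap.sum_apply,
      Representation.ofDistribMulAction_apply_apply, Representation.isTrivial_def,
      LinearMap.id_apply, hDsmul]
    exact Fintype.sum_equiv (MulAction.toPerm g⁻¹) _ _ fun _ => rfl⟩
  change (∑ c, D c) (r : S) = 0 at h
  rw [LinearMap.sum_apply, Finset.sum_congr rfl (g := fun _ =>
    φ (Ideal.Quotient.mk (fixedIdeal S (P : Subgroup G)) (r : S))), Finset.sum_const,
    Finset.card_univ, ← Nat.card_eq_fintype_card, ← Nat.cast_smul_eq_nsmul k] at h
  · exact (smul_eq_zero.mp h).resolve_left (sylow_index_cast_ne_zero k P)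
  · intro c _
    induction c using QuotientGroup.induction_on with
    | H a =>
      rw [hD]
      congr 2
      exact r.2 a⁻¹

theorem transferIdeal_le_idealRST (p : ℕ) :
    transferIdeal k S (nonSylowSet p G) ≤ idealRST k S G p :=
  Ideal.le_comap_map

theorem idealST_le_idealI (p : ℕ) [ExpChar k p] : idealST k S G p ≤ idealI S G p :=
  Ideal.map_le_iff_le_comap.mpr
    ((transferIdeal_le_nonSplitIdeal p).trans (nonSplitIdeal_le_idealRI p))

theorem idealI_le_of_transferIdeal_le (p : ℕ) [ExpChar k p] {Q : Ideal S} [Q.IsPrime]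
    (hQ : transferIdeal k S (nonSylowSet p G) ≤ Q.comap (algebraMap (InvRing k S G) S)) :
    idealI S G p ≤ Q := by
  obtain ⟨P, hP⟩ := exists_sylow_le_inertia p hQ
  exact (fixedIdealInter_sylowSet_le P).trans (fixedIdeal_le_iff.mpr hP)

theorem idealI_le_radical_idealST (p : ℕ) [ExpChar k p] :
    idealI S G p ≤ (idealST k S G p).radical := by
  rw [Ideal.radical_eq_sInf]
  refine le_sInf ?_
  rintro Q ⟨hQ, hprime⟩
  exact idealI_le_of_transferIdeal_le p (Ideal.map_le_iff_le_comap.mp hQ)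

theorem isIntegral_invRing : Algebra.IsIntegral (InvRing k S G) S :=
  Algebra.IsInvariant.isIntegral (InvRing k S G) S G

theorem exists_isPrime_comap_eq (𝔮 : Ideal (InvRing k S G)) [𝔮.IsPrime] :
    ∃ Q : Ideal S, Q.IsPrime ∧ Q.comap (algebraMap (InvRing k S G) S) = 𝔮 := by
  have := isIntegral_invRing (k := k) (S := S) (G := G)
  obtain ⟨Q, -, hQ⟩ := Ideal.exists_ideal_over_prime_of_isIntegral 𝔮 (⊥ : Ideal S) (by
    intro x hx
    obtain rfl : x = 0 := Subtype.ext hx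
    exact zero_mem 𝔮)
  exact ⟨Q, hQ⟩

theorem idealRI_le_radical_transferIdeal (p : ℕ) [ExpChar k p] :
    idealRI k S G p ≤ (transferIdeal k S (nonSylowSet p G)).radical := by
  rw [Ideal.radical_eq_sInf]
  refine le_sInf ?_
  rintro 𝔮 ⟨h𝔮, hprime⟩
  obtain ⟨Q, hQ, rfl⟩ := exists_isPrime_comap_eq 𝔮
  exact Ideal.comap_mono (idealI_le_of_transferIdeal_le p h𝔮)

end Ideals

/-! ### The maps of the diagram -/

section Maps

theorem isNilpotent_of_le_nilradical {A : Type*} [CommRing A] [IsNoetherianRing A] {J : Ideal A}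
    (h : J ≤ nilradical A) : IsNilpotent J := by
  obtain ⟨n, hn⟩ := IsNoetherianRing.isNilpotent_nilradical A
  exact ⟨n, le_bot_iff.mp ((Ideal.pow_right_mono h n).trans hn.le)⟩

theorem ker_factor_le_nilradical {A : Type*} [CommRing A] {a b : Ideal A} (h : a ≤ b)
    (hb : b ≤ a.radical) : RingHom.ker (Ideal.Quotient.factor h) ≤ nilradical (A ⧸ a) := by
  intro x hx
  obtain ⟨x, rfl⟩ := Ideal.Quotient.mk_surjective x
  rw [RingHom.mem_ker, Ideal.Quotient.factor_mk, Ideal.Quotient.eq_zero_iff_mem] at hx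
  obtain ⟨n, hn⟩ := hb hx
  refine ⟨n, ?_⟩
  rw [← map_pow]
  exact Ideal.Quotient.eq_zero_iff_mem.mpr hn

theorem factor_inducesUniversalHomeomorphism (k : Type*) [Field k] (p : ℕ) [ExpChar k p]
    {A : Type*} [CommRing A] [Algebra k A] {a b : Ideal A} (h : a ≤ b) (hb : b ≤ a.radical) :
    InducesUniversalHomeomorphism (Ideal.Quotient.factor h) :=
  inducesUniversalHomeomorphism_of_pow_mem_range p (algebraMap k (A ⧸ a)) _
    (ker_factor_le_nilradical h hb)
    fun x => ⟨0, by simpa using Ideal.Quotient.factor_surjective h x⟩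

variable {k S G : Type*} [Field k] [CommRing S] [Algebra k S]
  [Group G] [MulSemiringAction G S] [SMulCommClass G k S]

/-- The homomorphism `R/(R ∩ J) → (S/J)^G` induced by the inclusion of `R = S^G` in `S`. -/
def invQuotientMap (k : Type*) [Field k] [Algebra k S] [SMulCommClass G k S]
    {J : Ideal S} (hJ : IsStable G J) :
    InvRing k S G ⧸ J.comap (algebraMap (InvRing k S G) S) →+* quotientInvariants hJ :=
  (Ideal.quotientMap J (algebraMap (InvRing k S G) S) le_rfl).codRestrict _ fun x => by
    obtain ⟨r, rfl⟩ := Ideal.Quotient.mk_surjective x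
    rw [Ideal.quotientMap_mk, mk_mem_quotientInvariants]
    intro g
    have hr : g • algebraMap (InvRing k S G) S r = algebraMap (InvRing k S G) S r := r.2 g
    rw [hr, sub_self]
    exact zero_mem J

theorem invQuotientMap_injective {J : Ideal S} (hJ : IsStable G J) :
    Function.Injective (invQuotientMap k hJ) := fun _ _ h =>
  Ideal.quotientMap_injective (congrArg Subtype.val h)

theorem exists_pow_mem_range_invQuotientMap [Finite G] (p : ℕ) [ExpChar k p] {J : Ideal S}
    (hJ : IsStable G J) (x : quotientInvariants hJ) :
    ∃ n : ℕ, x ^ p ^ n ∈ (invQuotientMap k hJ).range := by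
  obtain ⟨x, hx⟩ := x
  obtain ⟨s, rfl⟩ := Ideal.Quotient.mk_surjective x
  obtain ⟨n, r, hr⟩ := exists_invariant_sub_mem (k := k) p ((mk_mem_quotientInvariants hJ s).mp hx)
  exact ⟨n, Ideal.Quotient.mk _ r, Subtype.ext hr⟩

theorem invQuotientMap_inducesUniversalHomeomorphism [Finite G] (p : ℕ) [ExpChar k p]
    {J : Ideal S} (hJ : IsStable G J) :
    InducesUniversalHomeomorphism (invQuotientMap k hJ) :=
  inducesUniversalHomeomorphism_of_pow_mem_range p
    (algebraMap k (InvRing k S G ⧸ J.comap (algebraMap (InvRing k S G) S))) _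
    ((RingHom.injective_iff_ker_eq_bot _).mp (invQuotientMap_injective (k := k) hJ) ▸ bot_le)
    (exists_pow_mem_range_invQuotientMap p hJ)

/-- The homomorphism `(S/J)^G → (S/J')^G` induced by the identity of `S`, where `J ⊆ J'`. -/
def quotientInvariantsMap {J J' : Ideal S} (hJ : IsStable G J) (hJ' : IsStable G J')
    (h : J ≤ J') : quotientInvariants hJ →+* quotientInvariants hJ' :=
  (Ideal.Quotient.factor h).restrict _ _ fun x hx => by
    obtain ⟨s, rfl⟩ := Ideal.Quotient.mk_surjective x
    rw [mk_mem_quotientInvariants] at hx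
    rw [Ideal.Quotient.factor_mk, mk_mem_quotientInvariants]
    exact fun g => h (hx g)

theorem ker_quotientInvariantsMap_le {J J' : Ideal S} (hJ : IsStable G J) (hJ' : IsStable G J')
    (h : J ≤ J') (hrad : J' ≤ J.radical) :
    (RingHom.ker (quotientInvariantsMap hJ hJ' h)).map (quotientInvariants hJ).subtype ≤
      nilradical (S ⧸ J) := by
  rw [Ideal.map_le_iff_le_comap]
  intro x hx
  exact ker_factor_le_nilradical h hrad (congrArg Subtype.val hx)

/-- The ring `(S/J)^G` need not be noetherian, so nilpotency is deduced from that of the nilradical of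
`S/J`. -/
theorem isNilpotent_ker_quotientInvariantsMap [IsNoetherianRing S] {J J' : Ideal S}
    (hJ : IsStable G J) (hJ' : IsStable G J') (h : J ≤ J') (hrad : J' ≤ J.radical) :
    IsNilpotent (RingHom.ker (quotientInvariantsMap hJ hJ' h)) := by
  obtain ⟨n, hn⟩ := isNilpotent_of_le_nilradical (ker_quotientInvariantsMap_le hJ hJ' h hrad)
  refine ⟨n, ?_⟩
  rw [← Ideal.map_pow] at hn
  exact (Ideal.map_eq_bot_iff_of_injective Subtype.val_injective).mp hn

theorem quotientInvariantsMap_inducesUniversalHomeomorphism [Finite G] (p : ℕ) [ExpChar k p]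
    {J J' : Ideal S} (hJ : IsStable G J) (hJ' : IsStable G J') (h : J ≤ J')
    (hrad : J' ≤ J.radical) :
    InducesUniversalHomeomorphism (quotientInvariantsMap hJ hJ' h) := by
  refine inducesUniversalHomeomorphism_of_pow_mem_range p
    ((invQuotientMap k hJ).comp
      (algebraMap k (InvRing k S G ⧸ J.comap (algebraMap (InvRing k S G) S)))) _ ?_ ?_
  · intro x hx
    obtain ⟨n, hn⟩ := ker_factor_le_nilradical h hrad (congrArg Subtype.val hx)
    exact ⟨n, Subtype.ext hn⟩
  · intro x
    obtain ⟨n, y, hy⟩ := exists_pow_mem_range_invQuotientMap (k := k) p hJ' x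
    obtain ⟨r, rfl⟩ := Ideal.Quotient.mk_surjective y
    exact ⟨n, invQuotientMap k hJ (Ideal.Quotient.mk _ r), hy⟩

end Maps

/-! ### The spectrum as a quotient of the fixed points of a Sylow subgroup -/

section Spectrum

variable {k S G : Type*} [Field k] [CommRing S] [Algebra k S]
  [Group G] [MulSemiringAction G S] [SMulCommClass G k S]

theorem inertia_smul (g : G) (Q : Ideal S) :
    (g • Q).inertia G = MulAut.conj g • Q.inertia G := by
  ext h
  rw [Subgroup.mem_pointwise_smul_iff_inv_smul_mem, ← map_inv, MulAut.smul_def,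
    MulAut.conj_apply, inv_inv]
  have key (s : S) : h • s - s ∈ g • Q ↔ (g⁻¹ * h * g) • (g⁻¹ • s) - g⁻¹ • s ∈ Q := by
    rw [Ideal.mem_pointwise_smul_iff_inv_smul_mem, smul_sub, smul_smul, smul_smul]
    simp [mul_assoc]
  refine ⟨fun H s => ?_, fun H s => (key s).mpr (H _)⟩
  have := (key (g • s)).mp (H _)
  rwa [inv_smul_smul] at this

variable [Finite G]

/-- Two primes whose inertia groups contain the Sylow subgroup `P` and that are in the same orbit
of `G` are in the same orbit of the normalizer of `P`: if `Q' = g Q`, then `P` and `g P g⁻¹` are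
Sylow subgroups of the inertia group of `Q'`, hence conjugate in it. -/
theorem exists_mem_normalizer_smul_eq (k : Type*) [Field k] {p : ℕ} [ExpChar k p] (P : Sylow p G)
    {Q Q' : Ideal S} (hQ : (P : Subgroup G) ≤ Q.inertia G) (hQ' : (P : Subgroup G) ≤ Q'.inertia G)
    {g : G} (hg : Q' = g • Q) :
    ∃ n ∈ Subgroup.normalizer ((P : Subgroup G) : Set G), n • Q = Q' := by
  have hgP : ((g • P : Sylow p G) : Subgroup G) ≤ Q'.inertia G := by
    rw [hg, inertia_smul, Sylow.coe_subgroup_smul]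
    exact Subgroup.pointwise_smul_le_pointwise_smul_iff.mpr hQ
  obtain ⟨e, he⟩ := exists_smul_sylow_eq k ((g • P).subtype hgP) (P.subtype hQ')
  have heP : (e : G) • g • P = P := by
    rw [Sylow.smul_subtype] at he
    exact Sylow.subtype_injective he
  refine ⟨e * g, ?_, ?_⟩
  · exact Sylow.smul_eq_iff_mem_normalizer.mp (by rw [mul_smul, heP])
  · rw [mul_smul, ← hg]
    exact Ideal.inertia_le_stabilizer Q' e.2

variable (k S) in
/-- For an ideal `a` of `R = S^G` between the ideal of transfers and `R ∩ I`, the spectrum of `R/a`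
is `Spec(S)^P / N_G(P)`: the contraction of primes from `S` to `R` is closed on `Spec(S)^P`, its
image is the set of primes containing `a`, and its fibres are the orbits of `N_G(P)`. -/
theorem nonempty_homeomorph_fixedSpectrumQuotient {p : ℕ} [ExpChar k p] (P : Sylow p G)
    {a : Ideal (InvRing k S G)} (h₁ : transferIdeal k S (nonSylowSet p G) ≤ a)
    (h₂ : a ≤ idealRI k S G p) :
    Nonempty (PrimeSpectrum (InvRing k S G ⧸ a) ≃ₜ
      FixedSpectrumQuotient S (P : Subgroup G)) := by
  let j := PrimeSpectrum.comap (Ideal.Quotient.mk a)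
  have hj : Topology.IsClosedEmbedding j :=
    PrimeSpectrum.isClosedEmbedding_comap_of_surjective _ _ Ideal.Quotient.mk_surjective
  have hjrange : Set.range j = PrimeSpectrum.zeroLocus (a : Set (InvRing k S G)) := by
    rw [range_comap_of_surjective _ _ Ideal.Quotient.mk_surjective, Ideal.mk_ker]
  let ψ : FixedSpectrum S (P : Subgroup G) → PrimeSpectrum (InvRing k S G) := fun Q =>
    PrimeSpectrum.comap (algebraMap (InvRing k S G) S) Q.1
  have hψcont : Continuous ψ := (PrimeSpectrum.continuous_comap _).comp continuous_subtype_val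
  have hψclosed : IsClosedMap ψ := by
    have hint : (algebraMap (InvRing k S G) S).IsIntegral :=
      algebraMap_isIntegral_iff.mpr isIntegral_invRing
    have hset : {Q : PrimeSpectrum S | ∀ h ∈ (P : Subgroup G), ∀ s : S, h • s - s ∈ Q.asIdeal} =
        PrimeSpectrum.zeroLocus (fixedIdeal S (P : Subgroup G) : Set S) :=
      Set.ext fun Q => (fixedIdeal_le_iff (Q := Q.asIdeal)).symm
    have hclosed := PrimeSpectrum.isClosed_zeroLocus (fixedIdeal S (P : Subgroup G) : Set S)
    rw [← hset] at hclosed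
    exact (PrimeSpectrum.isClosedMap_comap_of_isIntegral _ hint).comp
      hclosed.isClosedMap_subtype_val
  have hψ (Q) : ∃ y, j y = ψ Q := by
    change ψ Q ∈ Set.range j
    rw [hjrange]
    exact h₂.trans (Ideal.comap_mono ((fixedIdealInter_sylowSet_le P).trans
      (fixedIdeal_le_iff.mpr Q.2)))
  choose F hF using hψ
  have hjF : j ∘ F = ψ := funext hF
  have hFcont : Continuous F := hj.isInducing.continuous_iff.mpr (hjF ▸ hψcont)
  have hFclosed : IsClosedMap F := by
    intro C hC
    rw [hj.isClosed_iff_image_isClosed, ← Set.image_comp, hjF]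
    exact hψclosed C hC
  have hFsurj : Function.Surjective F := by
    intro y
    obtain ⟨Q, hQ, hQy⟩ := exists_isPrime_comap_eq (j y).asIdeal
    have hay : a ≤ (j y).asIdeal := by
      have : j y ∈ Set.range j := ⟨y, rfl⟩
      rwa [hjrange] at this
    obtain ⟨P', hP'⟩ := exists_sylow_le_inertia p (Q := Q) (hQy ▸ h₁.trans hay)
    obtain ⟨g, rfl⟩ := exists_smul_sylow_eq k P' P
    refine ⟨⟨⟨g • Q, Ideal.IsPrime.smul g⟩, ?_⟩, hj.injective ?_⟩
    · change _ ≤ (g • Q).inertia G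
      rw [inertia_smul, Sylow.coe_subgroup_smul]
      exact Subgroup.pointwise_smul_le_pointwise_smul_iff.mpr hP'
    · rw [hF]
      ext1
      rw [← hQy]
      exact Ideal.under_smul (InvRing k S G) Q g
  have hquot : Topology.IsQuotientMap (⟨F, hFcont⟩ : C(_, _)) :=
    hFclosed.isQuotientMap hFcont hFsurj
  have hker : Setoid.ker F = normalizerRel S (P : Subgroup G) := by
    ext Q Q'
    rw [Setoid.ker_def, ← hj.injective.eq_iff, hF, hF, PrimeSpectrum.ext_iff]
    constructor
    · intro h
      obtain ⟨g, hg⟩ := Algebra.IsInvariant.exists_smul_of_under_eq (InvRing k S G) S G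
        Q.1.asIdeal Q'.1.asIdeal h
      exact exists_mem_normalizer_smul_eq k P Q.2 Q'.2 hg
    · rintro ⟨g, -, hg⟩
      change Q.1.asIdeal.under _ = Q'.1.asIdeal.under _
      rw [← hg, Ideal.under_smul]
  have e : Quotient (Setoid.ker F) ≃ₜ PrimeSpectrum (InvRing k S G ⧸ a) := hquot.homeomorph
  rw [hker] at e
  exact ⟨e.symm⟩

end Spectrum

end InvariantSummands

open InvariantSummands in
theorem theorem3p3 {k S G : Type*} [Field k] [CommRing S] [Algebra k S] [IsNoetherianRing S]
    [Group G] [Finite G] [MulSemiringAction G S] [SMulCommClass G k S]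
    [IsNoetherianRing (InvRing k S G)] (p : ℕ) [ExpChar k p] :
    (∃ (ι₁ : BrauerQuotient k S G →+* InvariantSummandRing k S G)
       (ι₂ : BrauerQuotient k S G →+* InvRing k S G ⧸ idealRST k S G p)
       (ι₃ : InvariantSummandRing k S G →+* InvRing k S G ⧸ idealRI k S G p)
       (ι₄ : InvRing k S G ⧸ idealRST k S G p →+* InvRing k S G ⧸ idealRI k S G p)
       (ι₅ : invModST k S G p →+* invModI S G p)
       (ρ₁ : InvRing k S G ⧸ idealRST k S G p →+* invModST k S G p)
       (ρ₂ : InvRing k S G ⧸ idealRI k S G p →+* invModI S G p),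
      -- the maps are the natural ones, induced by the identity of `R` or `S` and by `R → S`
      (∀ r : InvRing k S G, ι₁ (Ideal.Quotient.mk _ r) = Ideal.Quotient.mk _ r) ∧
      (∀ r : InvRing k S G, ι₂ (Ideal.Quotient.mk _ r) = Ideal.Quotient.mk _ r) ∧
      (∀ r : InvRing k S G, ι₃ (Ideal.Quotient.mk _ r) = Ideal.Quotient.mk _ r) ∧
      (∀ r : InvRing k S G, ι₄ (Ideal.Quotient.mk _ r) = Ideal.Quotient.mk _ r) ∧
      (∀ (s : S) (hs : Ideal.Quotient.mk (idealST k S G p) s ∈ invModST k S G p),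
        (ι₅ ⟨Ideal.Quotient.mk (idealST k S G p) s, hs⟩ : S ⧸ idealI S G p) =
          Ideal.Quotient.mk (idealI S G p) s) ∧
      (∀ r : InvRing k S G,
        (ρ₁ (Ideal.Quotient.mk _ r) : S ⧸ idealST k S G p) =
          Ideal.Quotient.mk (idealST k S G p) (r : S)) ∧
      (∀ r : InvRing k S G,
        (ρ₂ (Ideal.Quotient.mk _ r) : S ⧸ idealI S G p) =
          Ideal.Quotient.mk (idealI S G p) (r : S)) ∧
      -- both squares commute
      ι₃.comp ι₁ = ι₄.comp ι₂ ∧ ρ₂.comp ι₄ = ι₅.comp ρ₁ ∧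
      -- surjectivity and injectivity
      Function.Surjective ι₁ ∧ Function.Surjective ι₂ ∧ Function.Surjective ι₃ ∧
      Function.Surjective ι₄ ∧ Function.Injective ρ₁ ∧ Function.Injective ρ₂ ∧
      -- nilpotent kernels
      IsNilpotent (RingHom.ker ι₁) ∧ IsNilpotent (RingHom.ker ι₂) ∧
      IsNilpotent (RingHom.ker ι₃) ∧ IsNilpotent (RingHom.ker ι₄) ∧
      IsNilpotent (RingHom.ker ι₅) ∧
      -- universal homeomorphisms
      InducesUniversalHomeomorphism ι₁ ∧ InducesUniversalHomeomorphism ι₂ ∧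
      InducesUniversalHomeomorphism ι₃ ∧ InducesUniversalHomeomorphism ι₄ ∧
      InducesUniversalHomeomorphism ι₅ ∧
      InducesUniversalHomeomorphism ρ₁ ∧ InducesUniversalHomeomorphism ρ₂) ∧
    -- both spectra are homeomorphic to `Spec(S)^P / N_G(P)`
    (∀ P : Sylow p G,
      Nonempty (PrimeSpectrum (BrauerQuotient k S G) ≃ₜ
        FixedSpectrumQuotient S (P : Subgroup G)) ∧
      Nonempty (PrimeSpectrum (InvariantSummandRing k S G) ≃ₜ
        FixedSpectrumQuotient S (P : Subgroup G))) := by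
  have hT := setOf_isPGroup_and_dvd_index k p G
  have hTJ : transferIdeal k S {H : Subgroup G | IsPGroup (ringExpChar k) H ∧
      ringChar k ∣ H.index} ≤ nonSplitIdeal k S G := hT ▸ transferIdeal_le_nonSplitIdeal p
  have hTS : transferIdeal k S {H : Subgroup G | IsPGroup (ringExpChar k) H ∧
      ringChar k ∣ H.index} ≤ idealRST k S G p := hT ▸ transferIdeal_le_idealRST p
  have hJI : nonSplitIdeal k S G ≤ idealRI k S G p := nonSplitIdeal_le_idealRI p
  have hSI : idealST k S G p ≤ idealI S G p := idealST_le_idealI p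
  have hRSI : idealRST k S G p ≤ idealRI k S G p := Ideal.comap_mono hSI
  have hrad : idealRI k S G p ≤ (transferIdeal k S {H : Subgroup G |
      IsPGroup (ringExpChar k) H ∧ ringChar k ∣ H.index}).radical :=
    hT ▸ idealRI_le_radical_transferIdeal p
  have hradS : idealI S G p ≤ (idealST k S G p).radical := idealI_le_radical_idealST p
  have h₁ := hJI.trans hrad
  have h₂ := hRSI.trans hrad
  have h₃ := hrad.trans (Ideal.radical_mono hTJ)
  have h₄ := hrad.trans (Ideal.radical_mono hTS)
  refine ⟨⟨Ideal.Quotient.factor hTJ, Ideal.Quotient.factor hTS, Ideal.Quotient.factor hJI,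
    Ideal.Quotient.factor hRSI,
    quotientInvariantsMap (isStable_extTransferIdeal k (nonSylowSet p G))
      (isStable_fixedIdealInter_sylow p) hSI,
    invQuotientMap k (isStable_extTransferIdeal k (nonSylowSet p G)),
    invQuotientMap k (isStable_fixedIdealInter_sylow p),
    fun _ => rfl, fun _ => rfl, fun _ => rfl, fun _ => rfl, fun _ _ => rfl, fun _ => rfl,
    fun _ => rfl, Ideal.Quotient.ringHom_ext rfl, Ideal.Quotient.ringHom_ext rfl,
    Ideal.Quotient.factor_surjective _, Ideal.Quotient.factor_surjective _,
    Ideal.Quotient.factor_surjective _, Ideal.Quotient.factor_surjective _,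
    invQuotientMap_injective _, invQuotientMap_injective _,
    isNilpotent_of_le_nilradical (ker_factor_le_nilradical hTJ h₁),
    isNilpotent_of_le_nilradical (ker_factor_le_nilradical hTS h₂),
    isNilpotent_of_le_nilradical (ker_factor_le_nilradical hJI h₃),
    isNilpotent_of_le_nilradical (ker_factor_le_nilradical hRSI h₄),
    isNilpotent_ker_quotientInvariantsMap _ _ hSI hradS,
    factor_inducesUniversalHomeomorphism k p hTJ h₁,
    factor_inducesUniversalHomeomorphism k p hTS h₂,
    factor_inducesUniversalHomeomorphism k p hJI h₃,
    factor_inducesUniversalHomeomorphism k p hRSI h₄,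
    quotientInvariantsMap_inducesUniversalHomeomorphism (k := k) p _ _ hSI hradS,
    invQuotientMap_inducesUniversalHomeomorphism p _,
    invQuotientMap_inducesUniversalHomeomorphism p _⟩,
    fun P => ⟨nonempty_homeomorph_fixedSpectrumQuotient k S P (hT ▸ le_rfl) (hTJ.trans hJI),
      nonempty_homeomorph_fixedSpectrumQuotient k S P (transferIdeal_le_nonSplitIdeal p) hJI⟩⟩
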